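/- Manifolds are smooth, finite-dimensional and without boundary. A Lie groupoid $\mathcal X_\bullet=(\mathcal X_1\rightrightarrows\mathcal X_0)$ is a groupoid whose set of objects $\mathcal X_0$ is a (Hausdorff, second countable) manifold and whose set of arrows $\mathcal X_1$ is a (possibly non-Hausdorff) manifold, such that all structure maps are smooth and the source $s$ and the target $t$ are submersions; a morphism $\phi_\bullet=(\phi_0,\phi_1)$ is a pair of smooth maps on objects and arrows commuting with the structure maps. A Lie groupoid is étale if $\dim\mathcal X_0=\dim\mathcal X_1$, proper if $\mathcal X_1$ is Hausdorff and $(s,t):\mathcal X_1\to\mathcal X_0\times\mathcal X_0$ is a proper map, and an étale groupoid is effective if any two arrows with the same source $x$ that induce the same germ at $x$ of local diffeomorphisms of $\mathcal X_0$ are equal (the germ induced by $g$ is that of $t\circ\sigma$, for $\sigma$ a local section of $s$ with $\sigma(x)=g$). A morphism $\phi_\bullet:\mathcal Y_\bullet\to\mathcal X_\bullet$ of Lie groupoids is a Morita equivalence if (V1) the map $t\circ\pi^1:\mathcal X_1\,{}_s\times_{\phi_0}\mathcal Y_0\to\mathcal X_0$ is a surjective submersion, where $\pi^1$ is the projection to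 $\mathcal X_1$; and (V2) the commutative square formed by $\phi_1:\mathcal Y_1\to\mathcal X_1$, $(s,t):\mathcal Y_1\to\mathcal Y_0\times\mathcal Y_0$, $(s,t):\mathcal X_1\to\mathcal X_0\times\mathcal X_0$ and $\phi_0\times\phi_0:\mathcal Y_0\times\mathcal Y_0\to\mathcal X_0\times\mathcal X_0$ is cartesian in the category of smooth manifolds. The (right) saturation $W_{\mathrm{sat}}$ of a class $W$ of morphisms of a (bi)category is the class of all morphisms $f:B\to A$ for which there are objects $C,D$ and morphisms $g:C\to B$, $h:D\to C$ such that both $f\circ g$ and $g\circ h$ belong to $W$; $W$ is (right) saturated if $W=W_{\mathrm{sat}}$. **Proposition.** Let $\xi_\bullet:\mathcal U_\bullet\to\mathcal Z_\bullet$, $\psi_\bullet:\mathcal Z_\bullet\to\mathcal Y_\bullet$, $\phi_\bullet:\mathcal Y_\bullet\to\mathcal X_\bullet$ be morphisms of étale groupoids such that $\phi_\bullet\circ\psi_\bullet$ and $\psi_\bullet\circ\xi_\bullet$ are Morita equivalences. Then $\phi_\bullet$ is a Morita equivalence. Moreover, the class of Morita equivalences in the $2$-category of étale groupoids is equal to its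 (right) saturation, and the same holds for the classes of Morita equivalences in the full sub-$2$-categories of proper étale groupoids and of proper effective étale groupoids. -/

import Mathlib

open CategoryTheory
open scoped Manifold ContDiff Topology

universe u

/-- A smooth (`C^∞`) finite-dimensional manifold without boundary, of pure dimension `dim`.
Separation and countability are not part of the structure; they are imposed where they are needed
(see `LieGroupoid`), because the manifold of arrows of a Lie groupoid need not be Hausdorff. -/
structure SmoothManifold where
  carrier : Type u
  dim : ℕ
  [topologicalSpace : TopologicalSpace carrier]
  [chartedSpace : ChartedSpace (EuclideanSpace ℝ (Fin dim)) carrier]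
  [isManifold : IsManifold (𝓡 dim) ∞ carrier]

namespace SmoothManifold

instance : CoeSort SmoothManifold.{u} (Type u) := ⟨SmoothManifold.carrier⟩

attribute [instance] topologicalSpace chartedSpace isManifold

/-- The model with corners of a manifold. -/
noncomputable abbrev model (M : SmoothManifold.{u}) :
    ModelWithCorners ℝ (EuclideanSpace ℝ (Fin M.dim)) (EuclideanSpace ℝ (Fin M.dim)) :=
  𝓡 M.dim

/-- Smooth maps between manifolds. -/
abbrev Smooth {M N : SmoothManifold.{u}} (f : M → N) : Prop :=
  ContMDiff M.model N.model ∞ f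

/-- Submersions between manifolds. -/
abbrev Submersion {M N : SmoothManifold.{u}} (f : M → N) : Prop :=
  Manifold.IsSubmersion M.model N.model ∞ f

end SmoothManifold

/-- The square
```
  P --p--> A
  |q       |f
  B --g--> C
```
is cartesian in the category of smooth manifolds: it commutes, `p` and `q` are smooth, and it has
the universal property of the fiber product with respect to smooth maps from all manifolds `T`. -/
def IsCartesianSquare
    {EP HP P EA HA A EB HB B C : Type*}
    [NormedAddCommGroup EP] [NormedSpace ℝ EP] [TopologicalSpace HP]
    [TopologicalSpace P] [ChartedSpace HP P]
    [NormedAddCommGroup EA] [NormedSpace ℝ EA] [TopologicalSpace HA]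
    [TopologicalSpace A] [ChartedSpace HA A]
    [NormedAddCommGroup EB] [NormedSpace ℝ EB] [TopologicalSpace HB]
    [TopologicalSpace B] [ChartedSpace HB B]
    (IP : ModelWithCorners ℝ EP HP) (IA : ModelWithCorners ℝ EA HA)
    (IB : ModelWithCorners ℝ EB HB)
    (p : P → A) (q : P → B) (f : A → C) (g : B → C) : Prop :=
  ContMDiff IP IA ∞ p ∧ ContMDiff IP IB ∞ q ∧ (∀ x, f (p x) = g (q x)) ∧
    ∀ (T : SmoothManifold.{u}) (a : T → A) (b : T → B),
      ContMDiff T.model IA ∞ a → ContMDiff T.model IB ∞ b → (∀ x, f (a x) = g (b x)) →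
        ∃! h : T → P, ContMDiff T.model IP ∞ h ∧ (∀ x, p (h x) = a x) ∧ (∀ x, q (h x) = b x)

/-- A fiber product `A ×_C B` of `f : A → C` and `g : B → C` in the category of smooth manifolds:
a manifold `P` with the two projections, completing `f`, `g` to a cartesian square.
It is unique up to a unique diffeomorphism. -/
structure FiberProduct {A B C : SmoothManifold.{u}} (f : A → C) (g : B → C) where
  P : SmoothManifold.{u}
  fst : P → A
  snd : P → B
  cartesian : IsCartesianSquare.{u} P.model A.model B.model fst snd f g

theorem FiberProduct.condition {A B C : SmoothManifold.{u}} {f : A → C} {g : B → C}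
    (F : FiberProduct f g) (x : F.P) : f (F.fst x) = g (F.snd x) :=
  F.cartesian.2.2.1 x

/-- A Lie groupoid: a groupoid with objects `Ob` and arrows `Ar`, source `s`, target `t`, unit `e`,
inverse `i` and multiplication `m`, where `Ob` is a Hausdorff second countable manifold, `Ar` is a
manifold, all structure maps are smooth, and `s` and `t` are submersions. The product `m g h` is
defined when the target of `g` is the source of `h` (diagrammatic order). -/
structure LieGroupoid where
  Ob : SmoothManifold.{u}
  Ar : SmoothManifold.{u}
  t2Space : T2Space Ob
  secondCountable : SecondCountableTopology Ob
  s : Ar → Ob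
  t : Ar → Ob
  e : Ob → Ar
  i : Ar → Ar
  m : (g h : Ar) → t g = s h → Ar
  s_e : ∀ x, s (e x) = x
  t_e : ∀ x, t (e x) = x
  s_m : ∀ g h w, s (m g h w) = s g
  t_m : ∀ g h w, t (m g h w) = t h
  s_i : ∀ g, s (i g) = t g
  t_i : ∀ g, t (i g) = s g
  m_assoc : ∀ g h k (w : t g = s h) (w' : t h = s k),
    m (m g h w) k ((t_m g h w).trans w') = m g (m h k w') (w.trans (s_m h k w').symm)
  e_m : ∀ g, m (e (s g)) g (t_e (s g)) = g
  m_e : ∀ g, m g (e (t g)) (s_e (t g)).symm = g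
  m_i : ∀ g, m g (i g) (s_i g).symm = e (s g)
  i_m : ∀ g, m (i g) g (t_i g) = e (t g)
  smooth_s : SmoothManifold.Smooth s
  smooth_t : SmoothManifold.Smooth t
  smooth_e : SmoothManifold.Smooth e
  smooth_i : SmoothManifold.Smooth i
  submersion_s : SmoothManifold.Submersion s
  submersion_t : SmoothManifold.Submersion t
  /-- The multiplication is smooth on the manifold `Ar ×_Ob Ar` of composable pairs. -/
  smooth_m : ∃ F : FiberProduct t s,
    SmoothManifold.Smooth (fun p : F.P => m (F.fst p) (F.snd p) (F.condition p))

namespace LieGroupoid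

/-- A morphism of Lie groupoids: a pair of smooth maps on objects and arrows that commutes with the
structure maps (compatibility with inverses is automatic). -/
@[ext]
structure Hom (Y X : LieGroupoid.{u}) where
  onOb : Y.Ob → X.Ob
  onAr : Y.Ar → X.Ar
  smooth_onOb : SmoothManifold.Smooth onOb
  smooth_onAr : SmoothManifold.Smooth onAr
  map_s : ∀ g, X.s (onAr g) = onOb (Y.s g)
  map_t : ∀ g, X.t (onAr g) = onOb (Y.t g)
  map_e : ∀ y, onAr (Y.e y) = X.e (onOb y)
  map_m : ∀ g h (w : Y.t g = Y.s h),
    onAr (Y.m g h w) = X.m (onAr g) (onAr h)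
      ((map_t g).trans ((congrArg onOb w).trans (map_s h).symm))

/-- Lie groupoids and their morphisms; `ψ ≫ φ` is the composite `φ ∘ ψ`. -/
instance : Category LieGroupoid.{u} where
  Hom := Hom
  id X :=
    { onOb := id
      onAr := id
      smooth_onOb := contMDiff_id
      smooth_onAr := contMDiff_id
      map_s := fun _ => rfl
      map_t := fun _ => rfl
      map_e := fun _ => rfl
      map_m := fun _ _ _ => rfl }
  comp ψ φ :=
    { onOb := φ.onOb ∘ ψ.onOb
      onAr := φ.onAr ∘ ψ.onAr
      smooth_onOb := φ.smooth_onOb.comp ψ.smooth_onOb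
      smooth_onAr := φ.smooth_onAr.comp ψ.smooth_onAr
      map_s := fun g => by simp [φ.map_s, ψ.map_s]
      map_t := fun g => by simp [φ.map_t, ψ.map_t]
      map_e := fun y => by simp [φ.map_e, ψ.map_e]
      map_m := fun g h w => by simp [φ.map_m, ψ.map_m] }

/-- Morita equivalences (weak equivalences, essential equivalences) `φ : Y ⟶ X` of Lie groupoids.
(V1) The map `t ∘ π¹` from the fiber product of `s : X.Ar → X.Ob` and `φ₀ : Y.Ob → X.Ob` to `X.Ob`
is a surjective submersion.
(V2) The square with sides `φ₁`, `(s, t)`, `(s, t)` and `φ₀ × φ₀` is cartesian. -/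
def moritaEquivalence : MorphismProperty LieGroupoid.{u} := fun Y X (φ : Hom Y X) =>
  (∃ F : FiberProduct X.s φ.onOb,
    Function.Surjective (X.t ∘ F.fst) ∧ SmoothManifold.Submersion (X.t ∘ F.fst)) ∧
  IsCartesianSquare.{u} Y.Ar.model X.Ar.model (Y.Ob.model.prod Y.Ob.model)
    φ.onAr (fun g => (Y.s g, Y.t g)) (fun g => (X.s g, X.t g)) (Prod.map φ.onOb φ.onOb)

/-- Étale groupoids: the manifolds of objects and of arrows have the same dimension. -/
def IsEtale : ObjectProperty LieGroupoid.{u} := fun X => X.Ob.dim = X.Ar.dim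

/-- Proper groupoids: the space of arrows is Hausdorff and `(s, t)` is a proper map. -/
def IsProper : ObjectProperty LieGroupoid.{u} := fun X =>
  T2Space X.Ar ∧ IsProperMap (fun g : X.Ar => (X.s g, X.t g))

/-- `σ` restricts to a smooth section of the source map on some open neighbourhood of `x`. -/
def IsLocalSection (X : LieGroupoid.{u}) (σ : X.Ob → X.Ar) (x : X.Ob) : Prop :=
  ∃ V : Set X.Ob, IsOpen V ∧ x ∈ V ∧ ContMDiffOn X.Ob.model X.Ar.model ∞ σ V ∧
    ∀ y ∈ V, X.s (σ y) = y

/-- Effective (étale) groupoids. In an étale groupoid each arrow `g` with source `x` is the value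
at `x` of a local section `σ` of `s`, whose germ at `x` is unique, and the germ at `x` of the local
diffeomorphism `t ∘ σ` is the effect of `g`. The groupoid is effective if arrows with the same
source and the same effect are equal. -/
def IsEffective : ObjectProperty LieGroupoid.{u} := fun X =>
  ∀ (x : X.Ob) (σ τ : X.Ob → X.Ar), X.IsLocalSection σ x → X.IsLocalSection τ x →
    X.t ∘ σ =ᶠ[𝓝 x] X.t ∘ τ → σ x = τ x

end LieGroupoid

/-- Étale groupoids. -/
abbrev EGpd := (LieGroupoid.IsEtale.{u}).FullSubcategory

/-- Proper étale groupoids. -/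
abbrev PEGpd := (LieGroupoid.IsEtale.{u} ⊓ LieGroupoid.IsProper.{u}).FullSubcategory

/-- Proper effective étale groupoids. -/
abbrev PEEGpd :=
  (LieGroupoid.IsEtale.{u} ⊓ LieGroupoid.IsProper.{u} ⊓ LieGroupoid.IsEffective.{u}).FullSubcategory

/-- The class of Morita equivalences of étale groupoids. -/
def wEGpd : MorphismProperty EGpd.{u} := fun _ _ f => LieGroupoid.moritaEquivalence f.hom

/-- The class of Morita equivalences of proper étale groupoids. -/
def wPEGpd : MorphismProperty PEGpd.{u} := fun _ _ f => LieGroupoid.moritaEquivalence f.hom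

/-- The class of Morita equivalences of proper effective étale groupoids. -/
def wPEEGpd : MorphismProperty PEEGpd.{u} := fun _ _ f => LieGroupoid.moritaEquivalence f.hom

/-- The (right) saturation of a class `W` of morphisms: all `f : B ⟶ A` such that there are
`g : C ⟶ B` and `h : D ⟶ C` with both `f ∘ g` and `g ∘ h` in `W`. Only the composition of
`1`-morphisms enters, so this makes sense in any bicategory. -/
def rightSaturation {𝒞 : Type*} [CategoryStruct 𝒞] (W : MorphismProperty 𝒞) :
    MorphismProperty 𝒞 := fun B _ f =>
  ∃ (C D : 𝒞) (g : C ⟶ B) (h : D ⟶ C), W (g ≫ f) ∧ W (h ≫ g)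

/-- `W` is (right) saturated if it is equal to its (right) saturation. -/
def IsRightSaturated {𝒞 : Type*} [CategoryStruct 𝒞] (W : MorphismProperty 𝒞) : Prop :=
  W = rightSaturation W

/-! For étale groupoids, $\phi$ is a Morita equivalence exactly when $\phi_0$ is a local
diffeomorphism and $\phi$ is an equivalence of abstract groupoids (`Hom.moritaEquivalence_iff`).
Both properties satisfy two-out-of-six at the last map.

From (V1), a local section of $t\circ\pi^1$ through the unit at $\phi_0(y)$ yields a local section
$\sigma$ of $\phi_0$ through $y$. From (V2), the units $e(\phi_0 w)$ lift to smooth arrows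
$w\to\sigma(\phi_0 w)$; as $s$ is étale these are units near $y$, so $\sigma$ is a two-sided local
inverse. Conversely, the fiber product in (V1) exists along a local diffeomorphism, and the lifts in
(V2), unique by full faithfulness, are smooth because locally they are given by sections of $s$.

For two-out-of-six, essential surjectivity of $\psi\circ\xi$ joins every object of $\mathcal Y$ by
an arrow to one in the image of $\psi_0\circ\xi_0$. There the claims are elementary
(`IsLocalDiffeomorphAt.of_two_out_of_six`, `IsFullyFaithful.of_two_out_of_six`), and both spread
along arrows. Identities give $W\subseteq W_{\mathrm{sat}}$, two-out-of-six the converse, in any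
full subcategory of étale groupoids. -/

section

open Filter Manifold Set

/-! ### Germs of sections and of local diffeomorphisms -/

section Germs

variable {E E' E'' H H' H'' M N Q : Type*}
  [NormedAddCommGroup E] [NormedSpace ℝ E] [TopologicalSpace H]
  [NormedAddCommGroup E'] [NormedSpace ℝ E'] [TopologicalSpace H']
  [NormedAddCommGroup E''] [NormedSpace ℝ E''] [TopologicalSpace H'']
  {I : ModelWithCorners ℝ E H} {J : ModelWithCorners ℝ E' H'} {K : ModelWithCorners ℝ E'' H''}
  [TopologicalSpace M] [ChartedSpace H M] [TopologicalSpace N] [ChartedSpace H' N]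
  [TopologicalSpace Q] [ChartedSpace H'' Q]
  {n : WithTop ℕ∞} {f : M → N} {g : N → Q} {x : M}

/-- `σ` is the germ at `f x` of a section of `f` through `x`. -/
structure IsSectionGerm (I : ModelWithCorners ℝ E H) (J : ModelWithCorners ℝ E' H')
    (n : WithTop ℕ∞) (f : M → N) (x : M) (σ : N → M) : Prop where
  apply_eq : σ (f x) = x
  smooth : ∀ᶠ q in 𝓝 (f x), ContMDiffAt J I n σ q
  right_inv : ∀ᶠ q in 𝓝 (f x), f (σ q) = q

theorem IsSectionGerm.tendsto {σ : N → M} (h : IsSectionGerm I J n f x σ) :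
    Tendsto σ (𝓝 (f x)) (𝓝 x) := by
  have := h.smooth.self_of_nhds.continuousAt.tendsto
  rwa [h.apply_eq] at this

theorem IsLocalDiffeomorphAt.of_germ {σ : N → M}
    (hf : ∀ᶠ p in 𝓝 x, ContMDiffAt I J n f p) (hσ : ∀ᶠ q in 𝓝 (f x), ContMDiffAt J I n σ q)
    (hl : ∀ᶠ p in 𝓝 x, σ (f p) = p) (hr : ∀ᶠ q in 𝓝 (f x), f (σ q) = q) :
    IsLocalDiffeomorphAt I J n f x := by
  obtain ⟨U, hU, hUo, hxU⟩ := eventually_nhds_iff.1 (hf.and hl)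
  obtain ⟨V, hV, hVo, hxV⟩ := eventually_nhds_iff.1 (hσ.and hr)
  have hfU : ContMDiffOn I J n f U := fun p hp => (hU p hp).1.contMDiffWithinAt
  have hσV : ContMDiffOn J I n σ V := fun q hq => (hV q hq).1.contMDiffWithinAt
  refine ⟨{ toFun := f, invFun := σ, source := U ∩ f ⁻¹' V, target := V ∩ σ ⁻¹' U,
            map_source' := ?_, map_target' := ?_, left_inv' := fun p hp => (hU p hp.1).2,
            right_inv' := fun q hq => (hV q hq.1).2,
            open_source := hfU.continuousOn.isOpen_inter_preimage hUo hVo,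
            open_target := hσV.continuousOn.isOpen_inter_preimage hVo hUo,
            contMDiffOn_toFun := hfU.mono inter_subset_left,
            contMDiffOn_invFun := hσV.mono inter_subset_left }, ⟨hxU, hxV⟩, fun _ _ => rfl⟩
  · rintro p ⟨hpU, hpV⟩
    exact ⟨hpV, by rw [mem_preimage, (hU p hpU).2]; exact hpU⟩
  · rintro q ⟨hqV, hqU⟩
    exact ⟨hqU, by rw [mem_preimage, (hV q hqV).2]; exact hqV⟩

theorem IsLocalDiffeomorphAt.eventually_contMDiffAt (h : IsLocalDiffeomorphAt I J n f x) :
    ∀ᶠ p in 𝓝 x, ContMDiffAt I J n f p := by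
  obtain ⟨Φ, hx, hΦ⟩ := h
  filter_upwards [Φ.open_source.mem_nhds hx] with p hp
  exact IsLocalDiffeomorphAt.contMDiffAt ⟨Φ, hp, hΦ⟩

theorem IsLocalDiffeomorphAt.exists_germ (h : IsLocalDiffeomorphAt I J n f x) :
    ∃ σ : N → M, IsSectionGerm I J n f x σ ∧ ∀ᶠ p in 𝓝 x, σ (f p) = p := by
  refine ⟨h.localInverse, ⟨h.localInverse_left_inv h.localInverse_mem_target, ?_,
    h.localInverse_eventuallyEq_right⟩, h.localInverse_eventuallyEq_left⟩
  filter_upwards [h.localInverse_open_source.mem_nhds h.localInverse_mem_source] with q hq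
  exact h.localInverse_contMDiffOn.contMDiffAt (h.localInverse_open_source.mem_nhds hq)

/-- Two germs of continuous maps with the same value agree if they agree after composition with a
local diffeomorphism. -/
theorem IsLocalDiffeomorphAt.eventuallyEq_of_comp {T : Type*} {l : Filter T} {a b : T → M}
    (h : IsLocalDiffeomorphAt I J n f x) (ha : Tendsto a l (𝓝 x)) (hb : Tendsto b l (𝓝 x))
    (hab : ∀ᶠ τ in l, f (a τ) = f (b τ)) : a =ᶠ[l] b := by
  obtain ⟨σ, -, hl⟩ := h.exists_germ
  filter_upwards [ha.eventually hl, hb.eventually hl, hab] with τ h₁ h₂ h₃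
  rw [← h₁, ← h₂, h₃]

/-- With `ρ` a local inverse of `g`, near `x` the map `f` is `ρ ∘ (g ∘ f)`, hence smooth; its
inverse is that of `g ∘ f` precomposed with `g`. -/
theorem IsLocalDiffeomorphAt.of_comp_left (hf : ContinuousAt f x)
    (hg : IsLocalDiffeomorphAt J K n g (f x)) (h : IsLocalDiffeomorphAt I K n (g ∘ f) x) :
    IsLocalDiffeomorphAt I J n f x := by
  obtain ⟨ρ, hρ, hρl⟩ := hg.exists_germ
  obtain ⟨σ, hσ, hσl⟩ := h.exists_germ
  have hgf : Tendsto (g ∘ f) (𝓝 x) (𝓝 (g (f x))) := h.contMDiffAt.continuousAt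
  have hfρ : ∀ᶠ p in 𝓝 x, ρ (g (f p)) = f p := hf.eventually hρl
  have hgt : Tendsto g (𝓝 (f x)) (𝓝 (g (f x))) := hg.contMDiffAt.continuousAt
  refine .of_germ (σ := σ ∘ g) ?_ ?_ hσl ?_
  · filter_upwards [hfρ.eventually_nhds, h.eventually_contMDiffAt, hgf.eventually hρ.smooth]
      with p h₁ h₂ h₃
    exact (ContMDiffAt.comp p h₃ h₂).congr_of_eventuallyEq (h₁.mono fun _ h => h.symm)
  · filter_upwards [hg.eventually_contMDiffAt, hgt.eventually hσ.smooth] with q h₁ h₂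
    exact ContMDiffAt.comp q h₂ h₁
  · filter_upwards [hgt.eventually hσ.right_inv, hgt.eventually (hσ.tendsto.eventually hfρ), hρl]
      with q h₁ h₂ h₃
    rw [Function.comp_apply, ← h₂, show g (f (σ (g q))) = g q from h₁, h₃]

theorem IsLocalDiffeomorphAt.of_comp_right (hf : IsLocalDiffeomorphAt I J n f x)
    (h : IsLocalDiffeomorphAt I K n (g ∘ f) x) : IsLocalDiffeomorphAt J K n g (f x) := by
  obtain ⟨ρ, hρ, hρl⟩ := hf.exists_germ
  obtain ⟨σ, hσ, hσl⟩ := h.exists_germ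
  have hft : Tendsto f (𝓝 x) (𝓝 (f x)) := hf.contMDiffAt.continuousAt
  have hg : ∀ᶠ q in 𝓝 (f x), g q = (g ∘ f) (ρ q) :=
    hρ.right_inv.mono fun q hq => by rw [Function.comp_apply, hq]
  refine .of_germ (σ := f ∘ σ) ?_ ?_ ?_ hσ.right_inv
  · filter_upwards [hg.eventually_nhds, hρ.smooth,
      hρ.tendsto.eventually h.eventually_contMDiffAt] with q h₁ h₂ h₃
    exact (ContMDiffAt.comp q h₃ h₂).congr_of_eventuallyEq h₁
  · filter_upwards [hσ.smooth, hσ.tendsto.eventually hf.eventually_contMDiffAt] with q h₁ h₂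
    exact ContMDiffAt.comp q h₂ h₁
  · filter_upwards [hρ.tendsto.eventually hσl, hρ.right_inv] with q h₁ h₂
    simp only [Function.comp_apply, h₂] at h₁ ⊢
    rw [h₁, h₂]

/-- The two-out-of-six property of local diffeomorphisms, at the last map. -/
theorem IsLocalDiffeomorphAt.of_two_out_of_six {E₀ H₀ L : Type*} [NormedAddCommGroup E₀]
    [NormedSpace ℝ E₀] [TopologicalSpace H₀] {I₀ : ModelWithCorners ℝ E₀ H₀} [TopologicalSpace L]
    [ChartedSpace H₀ L] {k : L → M} {u : L} (hk : ContinuousAt k u)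
    (hf : ∀ᶠ p in 𝓝 (k u), ContMDiffAt I J n f p)
    (hg : ∀ᶠ q in 𝓝 (f (k u)), ContMDiffAt J K n g q)
    (hfk : IsLocalDiffeomorphAt I₀ J n (f ∘ k) u)
    (hgf : IsLocalDiffeomorphAt I K n (g ∘ f) (k u)) :
    IsLocalDiffeomorphAt J K n g (f (k u)) := by
  obtain ⟨ρ, hρ, -⟩ := hfk.exists_germ
  obtain ⟨σ, hσ, hσl⟩ := hgf.exists_germ
  -- `f ∘ σ` is a right inverse of `g`. It is also a left inverse: points near `f (k u)` have the
  -- form `f p` with `p = k (ρ q)`, and `σ (g (f p)) = p`.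
  refine .of_germ (σ := f ∘ σ) hg ?_ ?_ hσ.right_inv
  · filter_upwards [hσ.smooth, hσ.tendsto.eventually hf] with q h₁ h₂
    exact ContMDiffAt.comp q h₂ h₁
  · filter_upwards [hρ.right_inv, hρ.tendsto.eventually (hk.eventually hσl)] with q h₁ h₂
    simp only [Function.comp_apply] at h₁ h₂ ⊢
    rw [h₁] at h₂
    rw [h₂, h₁]

/-- A germ of a continuous map is smooth if its composition with a local diffeomorphism is. -/
theorem IsLocalDiffeomorphAt.contMDiffAt_of_comp {f₁ : M → Q} {g : N → M} {y : N}
    (hf : IsLocalDiffeomorphAt I K n f₁ (g y)) (hg : ContinuousAt g y)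
    (h : ContMDiffAt J K n (f₁ ∘ g) y) : ContMDiffAt J I n g y := by
  obtain ⟨σ, hσ, hσl⟩ := hf.exists_germ
  exact (ContMDiffAt.comp y hσ.smooth.self_of_nhds h).congr_of_eventuallyEq
    ((hg.eventually hσl).mono fun _ h => h.symm)

end Germs

/-! ### Submersions and local diffeomorphisms -/

namespace SmoothManifold

variable {M N : SmoothManifold.{u}} {f : M → N} {x : M}

/-- In adapted charts `f` is a linear projection with fiber `F`. Freezing the `F`-coordinate at its
value `c` at `x` gives a section, which is an inverse when `F` is trivial. -/
theorem exists_isSectionGerm_of_isSubmersionAtOfComplement {F : Type*} [NormedAddCommGroup F]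
    [NormedSpace ℝ F] (h : IsSubmersionAtOfComplement F M.model N.model ∞ f x) :
    ∃ σ : N → M, IsSectionGerm M.model N.model ∞ f x σ ∧
      (Subsingleton F → ∀ᶠ p in 𝓝 x, σ (f p) = p) := by
  set φ := h.domChart with hφ
  set ψ := h.codChart with hψ
  set e := h.equiv with he
  have hxφ : x ∈ φ.source := h.mem_domChart_source
  have hxψ : f x ∈ ψ.source := h.mem_codChart_source
  have hw : ∀ z ∈ φ.target, ψ (f (φ.symm z)) = (e z).1 := fun z hz => by
    have hz' : z ∈ (φ.extend M.model).target := by simpa using hz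
    simpa using h.writtenInCharts hz'
  set c : F := (e (φ x)).2 with hc
  set ζ : N → EuclideanSpace ℝ (Fin M.dim) := fun q => e.symm (ψ q, c) with hζ
  have hζs : ∀ q ∈ ψ.source, ContMDiffAt N.model 𝓘(ℝ, EuclideanSpace ℝ (Fin M.dim)) ∞ ζ q := by
    intro q hq
    have h₁ : ContMDiffAt N.model N.model ∞ ψ q :=
      contMDiffAt_of_mem_maximalAtlas h.codChart_mem_maximalAtlas hq
    have h₂ : ContDiff ℝ ∞ (fun w : EuclideanSpace ℝ (Fin N.dim) => e.symm (w, c)) := by fun_prop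
    exact ContMDiffAt.comp (g := fun w => e.symm (w, c)) (f := ψ) q h₂.contMDiff.contMDiffAt h₁
  have hζx : ζ (f x) = φ x := by
    have := hw (φ x) (φ.map_source hxφ)
    rw [φ.left_inv hxφ] at this
    simp [hζ, this, hc]
  have hζt : ∀ᶠ q in 𝓝 (f x), ζ q ∈ φ.target := by
    refine (hζs _ hxψ).continuousAt.eventually (φ.open_target.mem_nhds ?_)
    rw [hζx]
    exact φ.map_source hxφ
  have hψn : ∀ᶠ q in 𝓝 (f x), q ∈ ψ.source := ψ.open_source.mem_nhds hxψ
  refine ⟨fun q => φ.symm (ζ q), ⟨?_, ?_, ?_⟩, fun _ => ?_⟩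
  · rw [hζx, φ.left_inv hxφ]
  · filter_upwards [hζt, hψn] with q h₁ h₂
    have h₃ : ContMDiffAt M.model M.model ∞ φ.symm (ζ q) :=
      contMDiffAt_symm_of_mem_maximalAtlas h.domChart_mem_maximalAtlas h₁
    exact ContMDiffAt.comp q h₃ (hζs q h₂)
  · filter_upwards [hζt, hψn] with q h₁ h₂
    refine ψ.injOn (h.source_subset_preimage_source (φ.map_target h₁)) h₂ ?_
    rw [hw _ h₁]
    simp [hζ]
  · filter_upwards [φ.open_source.mem_nhds hxφ] with p hp
    have := hw (φ p) (φ.map_source hp)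
    rw [φ.left_inv hp] at this
    have h₂ : (ψ (f p), c) = e (φ p) := Prod.ext this (Subsingleton.elim _ _)
    simp only [hζ, h₂, e.symm_apply_apply, φ.left_inv hp]

theorem Submersion.exists_isSectionGerm (h : Submersion f) (x : M) :
    ∃ σ : N → M, IsSectionGerm M.model N.model ∞ f x σ := by
  obtain ⟨σ, hσ, -⟩ := exists_isSectionGerm_of_isSubmersionAtOfComplement
    (h.isSubmersionOfComplement_complement x)
  exact ⟨σ, hσ⟩

theorem Submersion.isLocalDiffeomorphAt (h : Submersion f) (hd : M.dim = N.dim) (x : M) :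
    IsLocalDiffeomorphAt M.model N.model ∞ f x := by
  have hx := h.isSubmersionOfComplement_complement x
  obtain ⟨σ, hσ, hl⟩ := exists_isSectionGerm_of_isSubmersionAtOfComplement hx
  -- `finrank` also vanishes in infinite dimension, so finiteness of the complement has to precede
  -- the count.
  have : FiniteDimensional ℝ (EuclideanSpace ℝ (Fin N.dim) × h.complement) :=
    hx.equiv.toLinearEquiv.finiteDimensional
  have : FiniteDimensional ℝ h.complement :=
    .of_surjective (LinearMap.snd ℝ (EuclideanSpace ℝ (Fin N.dim)) h.complement)
      LinearMap.snd_surjective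
  have hr := hx.equiv.toLinearEquiv.finrank_eq
  rw [Module.finrank_prod, finrank_euclideanSpace_fin, finrank_euclideanSpace_fin] at hr
  have : Subsingleton h.complement := (Module.finrank_zero_iff (R := ℝ)).1 (by omega)
  exact .of_germ (.of_forall h.contMDiff) hσ.smooth (hl this) hσ.right_inv

theorem isSubmersionAtOfComplement_of_isLocalDiffeomorphAt
    (h : IsLocalDiffeomorphAt M.model N.model ∞ f x) :
    IsSubmersionAtOfComplement PUnit.{1} M.model N.model ∞ f x := by
  -- The derivative serves only as a linear isomorphism of the two model spaces. Through it the
  -- chart at `f x` becomes a chart `d` of `M` in which `f` reads as `L`.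
  let L : EuclideanSpace ℝ (Fin M.dim) ≃L[ℝ] EuclideanSpace ℝ (Fin N.dim) :=
    h.mfderivToContinuousLinearEquiv (by simp)
  have hf := h.contMDiffAt.continuousAt
  obtain ⟨Φ, hx, hΦ⟩ := h
  set ψ := chartAt (EuclideanSpace ℝ (Fin N.dim)) (f x) with hψ
  have hψm : ψ ∈ IsManifold.maximalAtlas N.model ∞ N := IsManifold.chart_mem_maximalAtlas _
  set d := (Φ.toOpenPartialHomeomorph.trans ψ).trans L.symm.toHomeomorph.toOpenPartialHomeomorph
    with hd
  have hds : ∀ p ∈ d.source, p ∈ Φ.source ∧ Φ p ∈ ψ.source := fun p hp => by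
    simpa [hd] using hp
  have hdt : ∀ z ∈ d.target, L z ∈ ψ.target ∧ ψ.symm (L z) ∈ Φ.target := fun z hz => by
    simpa [hd] using hz
  refine .mk_of_continuousAt hf (L.trans (ContinuousLinearEquiv.prodUnique ℝ _ PUnit.{1}).symm) d ψ
    ?_ (mem_chart_source _ _) ?_ hψm ?_
  · have : Φ x ∈ ψ.source := hΦ hx ▸ mem_chart_source _ (f x)
    simpa [hd] using ⟨hx, this⟩
  · refine OpenPartialHomeomorph.mem_maximalAtlas_of_contMDiffOn _ ?_ ?_
    · exact L.symm.contDiff.contMDiff.comp_contMDiffOn ((contMDiffOn_of_mem_maximalAtlas hψm).comp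
        (Φ.contMDiffOn.mono fun p hp => (hds p hp).1) fun p hp => (hds p hp).2)
    · exact Φ.contMDiffOn_invFun.comp ((contMDiffOn_symm_of_mem_maximalAtlas hψm).comp
        L.contDiff.contMDiff.contMDiffOn fun z hz => (hdt z hz).1) fun z hz => (hdt z hz).2
  · intro z hz
    have hz' : z ∈ d.target := by simpa using hz
    obtain ⟨h₁, h₂⟩ := hdt z hz'
    have h₃ : f (d.symm z) = ψ.symm (L z) :=
      (hΦ (Φ.map_target h₂)).trans (Φ.right_inv h₂)
    have h₄ : ψ (f (d.symm z)) = L z := by rw [h₃, ψ.right_inv h₁]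
    simpa using h₄

theorem submersion_of_isLocalDiffeomorph (h : IsLocalDiffeomorph M.model N.model ∞ f) :
    Submersion f :=
  IsSubmersionOfComplement.isSubmersion fun x =>
    isSubmersionAtOfComplement_of_isLocalDiffeomorphAt (h x)

end SmoothManifold

/-! ### Fiber products along local diffeomorphisms -/

namespace SmoothManifold

/-- The charted space structure pulled back along a local homeomorphism. -/
@[reducible]
noncomputable def pullbackChartedSpace {H A P : Type*} [TopologicalSpace H] [TopologicalSpace A]
    [ChartedSpace H A] [TopologicalSpace P] {f : P → A} (hf : IsLocalHomeomorph f) :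
    ChartedSpace H P where
  atlas := {e | ∃ p, e = (hf p).choose.trans (chartAt H (f p))}
  chartAt p := (hf p).choose.trans (chartAt H (f p))
  mem_chart_source p := by
    obtain ⟨h₁, h₂⟩ := (hf p).choose_spec
    have h₃ : (hf p).choose p = f p := (congrFun h₂ p).symm
    rw [OpenPartialHomeomorph.trans_source]
    exact ⟨h₁, by rw [mem_preimage, h₃]; exact mem_chart_source H (f p)⟩
  chart_mem_atlas p := ⟨p, rfl⟩

/-- The smooth structure pulled back along a local homeomorphism to a manifold. -/
noncomputable def pullback (A : SmoothManifold.{u}) {P : Type u} [TopologicalSpace P] {f : P → A}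
    (hf : IsLocalHomeomorph f) : SmoothManifold.{u} where
  carrier := P
  dim := A.dim
  chartedSpace := pullbackChartedSpace hf
  isManifold := by
    let := pullbackChartedSpace (H := EuclideanSpace ℝ (Fin A.dim)) hf
    refine isManifold_of_contDiffOn _ _ _ ?_
    rintro _ _ ⟨p, rfl⟩ ⟨q, rfl⟩
    set c₁ := chartAt (EuclideanSpace ℝ (Fin A.dim)) (f p)
    set c₂ := chartAt (EuclideanSpace ℝ (Fin A.dim)) (f q)
    have hc : ContDiffOn ℝ ∞ (c₁.symm.trans c₂) (c₁.symm.trans c₂).source := by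
      have := contMDiffOn_of_mem_contDiffGroupoid
        (HasGroupoid.compatible (G := contDiffGroupoid ∞ A.model)
        (chart_mem_atlas _ (f p)) (chart_mem_atlas _ (f q)))
      exact contMDiffOn_iff_contDiffOn.1 this
    obtain ⟨-, h₁⟩ := (hf p).choose_spec
    obtain ⟨-, h₂⟩ := (hf q).choose_spec
    set φ₁ := (hf p).choose
    set φ₂ := (hf q).choose
    -- Both `φ₁` and `φ₂` restrict `f`, so they cancel in the transition map, leaving a restriction
    -- of a transition map of `A`.
    have key : ∀ z ∈ ((φ₁.trans c₁).symm.trans (φ₂.trans c₂)).source,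
        z ∈ (c₁.symm.trans c₂).source ∧
          (φ₁.trans c₁).symm.trans (φ₂.trans c₂) z = c₁.symm.trans c₂ z := by
      intro z hz
      simp only [mfld_simps] at hz ⊢
      have h₃ : φ₂ (φ₁.symm (c₁.symm z)) = c₁.symm z := by
        rw [← h₂, h₁, φ₁.right_inv hz.1.2]
      rw [h₃] at hz ⊢
      exact ⟨⟨hz.1.1, hz.2.2⟩, rfl⟩
    simp only [modelWithCornersSelf_coe, modelWithCornersSelf_coe_symm, Function.id_comp,
      Function.comp_id, preimage_id, range_id, inter_univ]
    exact (hc.mono fun z hz => (key z hz).1).congr fun z hz => (key z hz).2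

theorem isLocalDiffeomorph_pullback (A : SmoothManifold.{u}) {P : Type u} [TopologicalSpace P]
    {f : P → A} (hf : IsLocalHomeomorph f) :
    IsLocalDiffeomorph (A.pullback hf).model A.model ∞ (M := A.pullback hf) f := by
  intro (p : P)
  let := pullbackChartedSpace (H := EuclideanSpace ℝ (Fin A.dim)) hf
  have : IsManifold A.model ∞ P := (A.pullback hf).isManifold
  change IsLocalDiffeomorphAt A.model A.model ∞ f p
  obtain ⟨hp, h₁⟩ := (hf p).choose_spec
  set φ := (hf p).choose with hφ
  set c := chartAt (EuclideanSpace ℝ (Fin A.dim)) (f p)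
  have he : φ.trans c ∈ IsManifold.maximalAtlas A.model ∞ P := IsManifold.chart_mem_maximalAtlas p
  have hc : c ∈ IsManifold.maximalAtlas A.model ∞ A := IsManifold.chart_mem_maximalAtlas (f p)
  have hpc : f p ∈ c.source := mem_chart_source _ _
  have h₂ : ∀ q, f q = φ q := congrFun h₁
  have hpt : f p ∈ φ.target := h₂ p ▸ φ.map_source hp
  refine .of_germ (σ := φ.symm) ?_ ?_ ?_ ?_
  · have ho : p ∈ (φ.trans c).source := by simpa [hp, ← h₂] using hpc
    filter_upwards [(φ.trans c).open_source.mem_nhds ho, 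
      (φ.trans c).open_source.eventually_mem ho |>.eventually_nhds] with q hq hq'
    have hqc : φ q ∈ φ.target ∧ φ q ∈ c.source := by
      simp only [mfld_simps] at hq
      exact ⟨φ.map_source hq.1, hq.2⟩
    have h₃ : ContMDiffAt A.model A.model ∞ c.symm (φ.trans c q) :=
      contMDiffAt_symm_of_mem_maximalAtlas hc (c.map_source hqc.2)
    refine (ContMDiffAt.comp q h₃ (contMDiffAt_of_mem_maximalAtlas he hq)).congr_of_eventuallyEq ?_
    filter_upwards [hq'] with r hr
    simp only [mfld_simps] at hr
    simp [h₂, hr.2]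
  · have ho : ∀ᶠ q in 𝓝 (f p), q ∈ φ.target ∧ q ∈ c.source :=
      (φ.open_target.eventually_mem hpt).and (c.open_source.eventually_mem hpc)
    filter_upwards [ho.eventually_nhds] with q hq
    have h₄ := hq.self_of_nhds
    have h₃ : ContMDiffAt A.model A.model ∞ (φ.trans c).symm (c q) :=
      contMDiffAt_symm_of_mem_maximalAtlas he (by simpa [h₄.2] using h₄.1)
    refine (ContMDiffAt.comp q h₃
      (contMDiffAt_of_mem_maximalAtlas hc h₄.2)).congr_of_eventuallyEq ?_
    filter_upwards [hq] with r hr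
    simp [hr.2]
  · filter_upwards [φ.open_source.mem_nhds hp] with q hq
    rw [h₂, φ.left_inv hq]
  · filter_upwards [φ.open_target.mem_nhds hpt] with q hq
    rw [h₂, φ.right_inv hq]

section FiberProduct

variable {A B C : SmoothManifold.{u}} {f : A → C} {g : B → C}

/-- The projection `A ×_C B → A` is a local homeomorphism if `B → C` is a local diffeomorphism. -/
theorem isLocalHomeomorph_fiberProduct_fst (hf : Smooth f)
    (hg : IsLocalDiffeomorph B.model C.model ∞ g) :
    IsLocalHomeomorph fun p : {p : A × B // f p.1 = g p.2} => p.1.1 := by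
  classical
  intro p
  obtain ⟨Φ, hΦ, hgΦ⟩ := hg p.1.2
  have hfc := hf.continuous
  -- The local inverse is `a ↦ (a, Φ⁻¹ (f a))`; off the target, `p` is a junk value.
  refine ⟨{ toFun := fun q => q.1.1
            invFun := fun a => if h : f a ∈ Φ.target then
              ⟨(a, Φ.invFun (f a)), 
                ((hgΦ (Φ.map_target h)).trans (Φ.right_inv h)).symm⟩ else p
            source := {q | q.1.2 ∈ Φ.source}
            target := f ⁻¹' Φ.target
            map_source' := fun q hq => ?_
            map_target' := fun a ha => ?_
            left_inv' := fun q hq => ?_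
            right_inv' := fun a ha => ?_
            open_source := Φ.open_source.preimage (continuous_snd.comp continuous_subtype_val)
            open_target := Φ.open_target.preimage hfc
            continuousOn_toFun := (continuous_fst.comp continuous_subtype_val).continuousOn
            continuousOn_invFun := ?_ }, hΦ, rfl⟩
  · rw [mem_preimage, q.2, hgΦ hq]
    exact Φ.map_source hq
  · rw [mem_preimage] at ha
    rw [dif_pos ha]
    exact Φ.map_target ha
  · have h : f q.1.1 ∈ Φ.target := by
      rw [q.2, hgΦ hq]
      exact Φ.map_source hq
    simp only [h, dite_true]
    refine Subtype.ext (Prod.ext rfl ?_)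
    change Φ.invFun (f q.1.1) = q.1.2
    rw [q.2, hgΦ hq]
    exact Φ.left_inv hq
  · rw [mem_preimage] at ha
    simp only [ha, dite_true]
  · have hi : Topology.IsInducing (Subtype.val : {p : A × B // f p.1 = g p.2} → A × B) := ⟨rfl⟩
    refine hi.continuousOn_iff.2 ?_
    refine (continuousOn_id.prodMk (Φ.contMDiffOn_invFun.continuousOn.comp hfc.continuousOn
      fun _ ha => ha)).congr fun a (ha : f a ∈ Φ.target) => ?_
    simp [ha]

/-- The fiber product along a local diffeomorphism. -/
noncomputable def fiberProduct (hf : Smooth f) (hg : IsLocalDiffeomorph B.model C.model ∞ g) :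
    FiberProduct f g where
  P := A.pullback (isLocalHomeomorph_fiberProduct_fst hf hg)
  fst p := p.1.1
  snd p := p.1.2
  cartesian := by
    have hfst := isLocalDiffeomorph_pullback A (isLocalHomeomorph_fiberProduct_fst hf hg)
    refine ⟨hfst.contMDiff, fun p => ?_, fun p => p.2, fun T a b ha hb hab => ?_⟩
    -- The second projection is smooth because its composite with the local diffeomorphism `g` is `f
    -- ∘ fst`.
    · have hc : Continuous fun p : {p : A × B // f p.1 = g p.2} => p.1.2 :=
        continuous_snd.comp continuous_subtype_val
      refine IsLocalDiffeomorphAt.contMDiffAt_of_comp (hg _) hc.continuousAt ?_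
      exact (ContMDiff.comp hf hfst.contMDiff).contMDiffAt.congr_of_eventuallyEq
        (.of_forall fun q => q.2.symm)
    · refine ⟨fun x => ⟨(a x, b x), hab x⟩, ⟨fun x => ?_, fun _ => rfl, fun _ => rfl⟩, ?_⟩
      · have hc : Continuous fun x => (⟨(a x, b x), hab x⟩ : {p : A × B // f p.1 = g p.2}) :=
          (ha.continuous.prodMk hb.continuous).subtype_mk _
        exact IsLocalDiffeomorphAt.contMDiffAt_of_comp (hfst _) hc.continuousAt (ha x)
      · rintro h ⟨-, h₁, h₂⟩
        exact funext fun x => Subtype.ext (Prod.ext (h₁ x) (h₂ x))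

theorem isLocalDiffeomorph_fiberProduct_fst (hf : Smooth f)
    (hg : IsLocalDiffeomorph B.model C.model ∞ g) :
    IsLocalDiffeomorph (fiberProduct hf hg).P.model A.model ∞ (fiberProduct hf hg).fst :=
  isLocalDiffeomorph_pullback A (isLocalHomeomorph_fiberProduct_fst hf hg)

end FiberProduct

end SmoothManifold

/-! ### Equivalences of abstract groupoids -/

namespace LieGroupoid

section Cancellation

variable {X : LieGroupoid.{u}}

/-- The composability proof depends on both arrows, so they cannot be rewritten in place; this
transports it. -/
theorem m_congr {g g' h h' : X.Ar} (hg : g = g') (hh : h = h') (w : X.t g = X.s h) :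
    X.m g h w = X.m g' h' (hg ▸ hh ▸ w) := by
  subst hg hh
  rfl

theorem m_m_i_left (l k : X.Ar) (w : X.s l = X.s k) :
    X.m l (X.m (X.i l) k ((X.t_i l).trans w))
      ((X.s_i l).symm.trans (X.s_m _ _ _).symm) = k := by
  rw [← X.m_assoc _ _ _ (X.s_i l).symm, m_congr ((X.m_i l).trans (congrArg X.e w)) rfl, X.e_m]

theorem m_i_m_left (l k : X.Ar) (w : X.t l = X.s k) :
    X.m (X.i l) (X.m l k w) ((X.t_i l).trans (X.s_m _ _ _).symm) = k := by
  rw [← X.m_assoc _ _ _ (X.t_i l), m_congr ((X.i_m l).trans (congrArg X.e w)) rfl, X.e_m]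

theorem m_m_i_right (k l : X.Ar) (w : X.t k = X.s l) :
    X.m (X.m k l w) (X.i l) ((X.t_m _ _ _).trans (X.s_i l).symm) = k := by
  rw [X.m_assoc _ _ _ w (X.s_i l).symm, m_congr rfl ((X.m_i l).trans (congrArg X.e w.symm)), X.m_e]

theorem m_i_m_right (k l : X.Ar) (w : X.t k = X.t l) :
    X.m (X.m k (X.i l) (w.trans (X.s_i l).symm)) l ((X.t_m _ _ _).trans (X.t_i l)) = k := by
  rw [X.m_assoc _ _ _ (w.trans (X.s_i l).symm) (X.t_i l),
    m_congr rfl ((X.i_m l).trans (congrArg X.e w.symm)), X.m_e]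

theorem m_left_cancel {l k k' : X.Ar} (w : X.t l = X.s k) (w' : X.t l = X.s k')
    (h : X.m l k w = X.m l k' w') : k = k' := by
  rw [← m_i_m_left l k w, m_congr rfl h, m_i_m_left]

theorem m_right_cancel {l k k' : X.Ar} (w : X.t k = X.s l) (w' : X.t k' = X.s l)
    (h : X.m k l w = X.m k' l w') : k = k' := by
  rw [← m_m_i_right k l w, m_congr h rfl, m_m_i_right]

end Cancellation

namespace Hom

variable {U Z Y X : LieGroupoid.{u}}

/-- `φ` is bijective from the arrows `y → y'` to the arrows `φ y → φ y'`. -/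
def BijectiveOnArrows (φ : Hom Y X) (y y' : Y.Ob) : Prop :=
  ∀ g, X.s g = φ.onOb y → X.t g = φ.onOb y' → ∃! k, φ.onAr k = g ∧ Y.s k = y ∧ Y.t k = y'

/-- `φ` is fully faithful as a functor of abstract groupoids. -/
def IsFullyFaithful (φ : Hom Y X) : Prop := ∀ y y', φ.BijectiveOnArrows y y'

/-- `φ` is essentially surjective as a functor of abstract groupoids. -/
def IsEssSurj (φ : Hom Y X) : Prop := ∀ x, ∃ y g, X.s g = φ.onOb y ∧ X.t g = x

/-- Composition with `l` in `Y` and with `φ l` in `X` are bijections on arrows, compatible with `φ`.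
-/
theorem BijectiveOnArrows.of_source {φ : Hom Y X} {l : Y.Ar} {y' : Y.Ob}
    (h : φ.BijectiveOnArrows (Y.s l) y') : φ.BijectiveOnArrows (Y.t l) y' := by
  intro g hs ht
  have wg : X.t (φ.onAr l) = X.s g := (φ.map_t l).trans hs.symm
  obtain ⟨k, ⟨hkg, hks, hkt⟩, hku⟩ := h (X.m (φ.onAr l) g wg) ((X.s_m _ _ _).trans (φ.map_s l))
    ((X.t_m _ _ _).trans ht)
  have wk : Y.t (Y.i l) = Y.s k := (Y.t_i l).trans hks.symm
  refine ⟨Y.m (Y.i l) k wk, ⟨?_, (Y.s_m _ _ _).trans (Y.s_i l), (Y.t_m _ _ _).trans hkt⟩, ?_⟩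
  -- Cancelling `φ l` avoids any appeal to compatibility of `φ` with inverses.
  · refine m_left_cancel (by rw [φ.map_t, φ.map_s, Y.s_m, Y.s_i]) wg
      ((φ.map_m l _ ((Y.s_i l).symm.trans (Y.s_m _ _ _).symm)).symm.trans ?_)
    rw [m_m_i_left l k hks.symm, hkg]
  · rintro k' ⟨hk'g, hk's, hk't⟩
    have := hku (Y.m l k' hk's.symm) ⟨?_, Y.s_m _ _ _, (Y.t_m _ _ _).trans hk't⟩
    · rw [m_congr rfl this.symm, m_i_m_left]
    · rw [φ.map_m, m_congr rfl hk'g]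

theorem BijectiveOnArrows.of_target {φ : Hom Y X} {l : Y.Ar} {y : Y.Ob}
    (h : φ.BijectiveOnArrows y (Y.s l)) : φ.BijectiveOnArrows y (Y.t l) := by
  intro g hs ht
  have wg : X.t g = X.s (X.i (φ.onAr l)) := ht.trans ((φ.map_t l).symm.trans (X.s_i _).symm)
  obtain ⟨k, ⟨hkg, hks, hkt⟩, hku⟩ := h (X.m g (X.i (φ.onAr l)) wg) ((X.s_m _ _ _).trans hs)
    ((X.t_m _ _ _).trans ((X.t_i _).trans (φ.map_s l)))
  refine ⟨Y.m k l hkt, ⟨?_, (Y.s_m _ _ _).trans hks, Y.t_m _ _ _⟩, ?_⟩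
  · rw [φ.map_m, m_congr hkg rfl, m_i_m_right]
    exact ht.trans (φ.map_t l).symm
  · rintro k' ⟨hk'g, hk's, hk't⟩
    have wk' : Y.t k' = Y.s (Y.i l) := hk't.trans (Y.s_i l).symm
    have := hku (Y.m k' (Y.i l) wk') ⟨?_, (Y.s_m _ _ _).trans hk's, (Y.t_m _ _ _).trans (Y.t_i l)⟩
    · rw [m_congr this.symm rfl, m_i_m_right _ _ hk't]
    · refine m_right_cancel (l := φ.onAr l) (by rw [φ.map_t, φ.map_s, Y.t_m, Y.t_i])
        ((X.t_m _ _ _).trans (X.t_i _))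
        ((φ.map_m _ l ((Y.t_m _ _ _).trans (Y.t_i l))).symm.trans ?_)
      rw [m_i_m_right k' l hk't, hk'g, m_i_m_right]
      exact ht.trans (φ.map_t l).symm

/-- If a composite is essentially surjective, so is its last map. -/
theorem IsEssSurj.of_comp {ψ : Z ⟶ Y} {φ : Y ⟶ X} (h : IsEssSurj (ψ ≫ φ)) : IsEssSurj φ :=
  fun x => let ⟨z, g, hs, ht⟩ := h x
    ⟨ψ.onOb z, g, hs, ht⟩

/-- The two-out-of-six property of equivalences of abstract groupoids, at the last map. -/
theorem IsFullyFaithful.of_two_out_of_six {ξ : U ⟶ Z} {ψ : Z ⟶ Y} {φ : Y ⟶ X}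
    (h : IsFullyFaithful (ψ ≫ φ)) (h' : IsFullyFaithful (ξ ≫ ψ)) (hs : IsEssSurj (ξ ≫ ψ)) :
    IsFullyFaithful φ := by
  intro y y'
  obtain ⟨v, l, hl, rfl⟩ := hs y
  obtain ⟨v', l', hl', rfl⟩ := hs y'
  -- Moving along `l` and `l'` reduces to objects in the image of `ξ ≫ ψ`.
  refine .of_source (.of_target ?_)
  rw [hl, hl']
  intro g hgs hgt
  obtain ⟨c, ⟨hcg, hcs, hct⟩, hcu⟩ := h (ξ.onOb v) (ξ.onOb v') g hgs hgt
  refine ⟨ψ.onAr c, ⟨hcg, (ψ.map_s c).trans (congrArg ψ.onOb hcs),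
    (ψ.map_t c).trans (congrArg ψ.onOb hct)⟩, ?_⟩
  -- `k` lifts to an arrow `d` of `U`; faithfulness of `ψ ≫ φ` forces `ξ d = c`, whence `k = ψ c`.
  rintro k ⟨hkg, hks, hkt⟩
  obtain ⟨d, ⟨hdk, hds, hdt⟩, -⟩ := h' v v' k hks hkt
  rw [← hcu (ξ.onAr d) ⟨(congrArg φ.onAr hdk).trans hkg, (ξ.map_s d).trans (congrArg ξ.onOb hds),
    (ξ.map_t d).trans (congrArg ξ.onOb hdt)⟩]
  exact hdk.symm

end Hom

end LieGroupoid

/-! ### Morita equivalences of étale groupoids -/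

namespace SmoothManifold

/-- An open subset of a manifold, as a manifold. -/
noncomputable def restrict (M : SmoothManifold.{u}) (W : TopologicalSpace.Opens M) :
    SmoothManifold.{u} where
  carrier := W
  dim := M.dim

theorem smooth_restrict_val (M : SmoothManifold.{u}) (W : TopologicalSpace.Opens M) :
    Smooth (M := M.restrict W) (N := M) Subtype.val :=
  (contMDiff_subtype_val : ContMDiff M.model M.model ∞ (Subtype.val : W → M))

end SmoothManifold

namespace LieGroupoid

variable {U Z Y X : LieGroupoid.{u}}

theorem IsEtale.isLocalDiffeomorph_s (hX : IsEtale X) :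
    IsLocalDiffeomorph X.Ar.model X.Ob.model ∞ X.s :=
  SmoothManifold.Submersion.isLocalDiffeomorphAt X.submersion_s (Eq.symm hX)

theorem IsEtale.isLocalDiffeomorph_t (hX : IsEtale X) :
    IsLocalDiffeomorph X.Ar.model X.Ob.model ∞ X.t :=
  SmoothManifold.Submersion.isLocalDiffeomorphAt X.submersion_t (Eq.symm hX)

namespace Hom

/-- As `s` and `t` are étale, `φ₀ ∘ s = s ∘ φ₁` carries the property to `φ₁` at `k`, and `φ₀ ∘ t = t
∘ φ₁` carries it back to `φ₀` at the target. -/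
theorem isLocalDiffeomorphAt_target {φ : Hom Y X} (hY : IsEtale Y) (hX : IsEtale X) (k : Y.Ar)
    (h : IsLocalDiffeomorphAt Y.Ob.model X.Ob.model ∞ φ.onOb (Y.s k)) :
    IsLocalDiffeomorphAt Y.Ob.model X.Ob.model ∞ φ.onOb (Y.t k) := by
  have hs : X.s ∘ φ.onAr = φ.onOb ∘ Y.s := funext φ.map_s
  have ht : φ.onOb ∘ Y.t = X.t ∘ φ.onAr := funext fun g => (φ.map_t g).symm
  have h₁ : IsLocalDiffeomorphAt Y.Ar.model X.Ar.model ∞ φ.onAr k := by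
    refine .of_comp_left φ.smooth_onAr.continuous.continuousAt (hX.isLocalDiffeomorph_s _) ?_
    rw [hs]
    exact (hY.isLocalDiffeomorph_s k).comp _ _ h
  refine .of_comp_right (hY.isLocalDiffeomorph_t k) ?_
  rw [ht]
  exact h₁.comp _ _ (hX.isLocalDiffeomorph_t _)

/-- The universal property is tested on constant maps from `Y.Ob`, a manifold that contains the
point `y`. -/
theorem isFullyFaithful_of_isCartesianSquare {φ : Hom Y X}
    (h : IsCartesianSquare.{u} Y.Ar.model X.Ar.model (Y.Ob.model.prod Y.Ob.model)
      φ.onAr (fun g => (Y.s g, Y.t g)) (fun g => (X.s g, X.t g)) (Prod.map φ.onOb φ.onOb)) :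
    φ.IsFullyFaithful := by
  intro y y' g hs ht
  obtain ⟨k, ⟨-, hk, hk'⟩, hu⟩ := h.2.2.2 Y.Ob (fun _ => g) (fun _ => (y, y')) contMDiff_const
    contMDiff_const fun _ => Prod.ext hs ht
  refine ⟨k y, ⟨hk y, congrArg Prod.fst (hk' y), congrArg Prod.snd (hk' y)⟩, ?_⟩
  rintro l ⟨hl, hls, hlt⟩
  exact congrFun (hu (fun _ => l) ⟨contMDiff_const, fun _ => hl, fun _ => Prod.ext hls hlt⟩) y

theorem exists_isSectionGerm {φ : Hom Y X} (hX : IsEtale X) (F : FiberProduct X.s φ.onOb)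
    (hF : SmoothManifold.Submersion (X.t ∘ F.fst)) (y : Y.Ob) :
    ∃ σ, IsSectionGerm Y.Ob.model X.Ob.model ∞ φ.onOb y σ := by
  obtain ⟨h, ⟨-, h₁, h₂⟩, -⟩ := F.cartesian.2.2.2 Y.Ob (fun y => X.e (φ.onOb y)) id
    (X.smooth_e.comp φ.smooth_onOb) contMDiff_id fun y => X.s_e _
  obtain ⟨ρ, hρ⟩ := SmoothManifold.Submersion.exists_isSectionGerm hF (h y)
  have hp : (X.t ∘ F.fst) (h y) = φ.onOb y := by rw [Function.comp_apply, h₁, X.t_e]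
  obtain ⟨hρe, hρs, hρr⟩ := hρ
  have hρt := (IsSectionGerm.mk hρe hρs hρr).tendsto
  rw [hp] at hρe hρs hρr hρt
  have hfst : Tendsto (F.fst ∘ ρ) (𝓝 (φ.onOb y)) (𝓝 (X.e (φ.onOb y))) := by
    rw [← h₁ y]
    exact (F.cartesian.1.continuous.tendsto _).comp hρt
  -- The first component of `ρ` is a section of the étale map `t` through a unit, hence consists of
  -- units. Their source is `φ₀` of the second component, which is therefore a section of `φ₀`.
  have he : F.fst ∘ ρ =ᶠ[𝓝 (φ.onOb y)] X.e := by
    refine (hX.isLocalDiffeomorph_t _).eventuallyEq_of_comp hfst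
      (X.smooth_e.continuous.tendsto _) ?_
    filter_upwards [hρr] with x hx
    rw [X.t_e]
    exact hx
  refine ⟨F.snd ∘ ρ, ?_, ?_, ?_⟩
  · rw [Function.comp_apply, hρe, h₂, id]
  · filter_upwards [hρs] with x hx
    exact ContMDiffAt.comp x F.cartesian.2.1.contMDiffAt hx
  · filter_upwards [he] with x hx
    rw [Function.comp_apply] at hx ⊢
    rw [← F.condition, hx, X.s_e]

theorem isLocalDiffeomorph_onOb {φ : Hom Y X} (hY : IsEtale Y) (hX : IsEtale X)
    (h : @moritaEquivalence Y X φ) : IsLocalDiffeomorph Y.Ob.model X.Ob.model ∞ φ.onOb := by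
  obtain ⟨⟨F, -, hF⟩, hc⟩ := h
  intro y
  obtain ⟨σ, hσ⟩ := exists_isSectionGerm hX F hF y
  obtain ⟨V, hV, hVo, hyV⟩ := eventually_nhds_iff.1 (hσ.smooth.and hσ.right_inv)
  -- The test manifold is the open set where `σ ∘ φ₀` is smooth and `φ₀ ∘ σ ∘ φ₀ = φ₀`.
  let W : TopologicalSpace.Opens Y.Ob := ⟨φ.onOb ⁻¹' V, hVo.preimage φ.smooth_onOb.continuous⟩
  let T : SmoothManifold.{u} := Y.Ob.restrict W
  let ι : T → Y.Ob := Subtype.val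
  have hι : ContMDiff T.model Y.Ob.model ∞ ι := Y.Ob.smooth_restrict_val W
  have hb : ContMDiff T.model Y.Ob.model ∞ fun w => σ (φ.onOb (ι w)) := fun w =>
    ContMDiffAt.comp w (hV _ w.2).1 (φ.smooth_onOb.comp hι w)
  obtain ⟨h, ⟨hh, h₁, h₂⟩, -⟩ := hc.2.2.2 T (fun w => X.e (φ.onOb (ι w)))
    (fun w => (ι w, σ (φ.onOb (ι w)))) (X.smooth_e.comp (φ.smooth_onOb.comp hι))
    (hι.prodMk hb) fun w =>
      Prod.ext (X.s_e _) ((X.t_e _).trans (hV _ w.2).2.symm)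
  have hs : ∀ w, Y.s (h w) = ι w := fun w => congrArg Prod.fst (h₂ w)
  have ht : ∀ w, Y.t (h w) = σ (φ.onOb (ι w)) := fun w => congrArg Prod.snd (h₂ w)
  let y₀ : T := ⟨y, hyV⟩
  have hy₀ : h y₀ = Y.e y := by
    refine (isFullyFaithful_of_isCartesianSquare hc y y (X.e (φ.onOb y)) (X.s_e _)
      (X.t_e _)).unique ⟨h₁ y₀, hs y₀, (ht y₀).trans hσ.apply_eq⟩ ⟨φ.map_e y, Y.s_e y, Y.t_e y⟩
  -- `h` and the units are lifts of `ι` along the étale map `s` that agree at `y₀`; comparing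
  -- targets then gives `σ (φ₀ w) = w`.
  have he : h =ᶠ[𝓝 y₀] Y.e ∘ ι := by
    refine (hY.isLocalDiffeomorph_s (Y.e y)).eventuallyEq_of_comp ?_ ?_ (.of_forall fun w => ?_)
    · rw [← hy₀]
      exact hh.continuous.tendsto _
    · exact (Y.smooth_e.comp hι).continuous.tendsto y₀
    · rw [hs, Function.comp_apply, Y.s_e]
  have hl : ∀ᶠ w in 𝓝 y₀, σ (φ.onOb (ι w)) = ι w := by
    filter_upwards [he] with w hw
    rw [← ht, hw, Function.comp_apply, Y.t_e]
  refine .of_germ (.of_forall φ.smooth_onOb) hσ.smooth ?_ hσ.right_inv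
  have hm : map ι (𝓝 y₀) = 𝓝 y := W.isOpen.isOpenEmbedding_subtypeVal.map_nhds_eq y₀
  rw [← hm]
  exact hl

theorem isEssSurj_of_moritaEquivalence {φ : Hom Y X} (h : @moritaEquivalence Y X φ) :
    φ.IsEssSurj := by
  obtain ⟨⟨F, hF, -⟩, -⟩ := h
  intro x
  obtain ⟨p, hp⟩ := hF x
  exact ⟨F.snd p, F.fst p, F.condition p, hp⟩

theorem isCartesianSquare_of_isFullyFaithful {φ : Hom Y X} (hY : IsEtale Y) (hX : IsEtale X)
    (hφ : IsLocalDiffeomorph Y.Ob.model X.Ob.model ∞ φ.onOb) (h : φ.IsFullyFaithful) :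
    IsCartesianSquare.{u} Y.Ar.model X.Ar.model (Y.Ob.model.prod Y.Ob.model)
      φ.onAr (fun g => (Y.s g, Y.t g)) (fun g => (X.s g, X.t g)) (Prod.map φ.onOb φ.onOb) := by
  refine ⟨φ.smooth_onAr, Y.smooth_s.prodMk Y.smooth_t,
    fun g => Prod.ext (φ.map_s g) (φ.map_t g), fun T a b ha hb hab => ?_⟩
  choose k hk hku using fun τ => h (b τ).1 (b τ).2 (a τ) (congrArg Prod.fst (hab τ))
    (congrArg Prod.snd (hab τ))
  refine ⟨k, ⟨fun τ => ?_, fun τ => (hk τ).1, fun τ => Prod.ext (hk τ).2.1 (hk τ).2.2⟩, ?_⟩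
  -- Near `τ`, the pointwise lift `k` is `σ` applied to the required source. This smooth candidate
  -- lies over `a` because `s` is étale on `X`, has the right target because `φ₀` is étale, and
  -- equals `k` by uniqueness.
  · obtain ⟨σ, hσ, -⟩ := (hY.isLocalDiffeomorph_s (k τ)).exists_germ
    have hb₁ : ContMDiff T.model Y.Ob.model ∞ fun τ => (b τ).1 := contMDiff_fst.comp hb
    have hb₂ : ContMDiff T.model Y.Ob.model ∞ fun τ => (b τ).2 := contMDiff_snd.comp hb
    have hb₁t : Tendsto (fun τ => (b τ).1) (𝓝 τ) (𝓝 (Y.s (k τ))) := by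
      rw [(hk τ).2.1]
      exact hb₁.continuous.tendsto τ
    have hl : Tendsto (fun τ => σ (b τ).1) (𝓝 τ) (𝓝 (k τ)) := hσ.tendsto.comp hb₁t
    have h₁ : ∀ᶠ ζ in 𝓝 τ, Y.s (σ (b ζ).1) = (b ζ).1 := hb₁t.eventually hσ.right_inv
    have h₂ : (fun ζ => φ.onAr (σ (b ζ).1)) =ᶠ[𝓝 τ] a := by
      refine (hX.isLocalDiffeomorph_s (φ.onAr (k τ))).eventuallyEq_of_comp
        ((φ.smooth_onAr.continuous.tendsto _).comp hl) ?_ ?_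
      · rw [(hk τ).1]
        exact ha.continuous.tendsto τ
      · filter_upwards [h₁] with ζ hζ
        rw [φ.map_s, hζ]
        exact (congrArg Prod.fst (hab ζ)).symm
    have h₃ : (fun ζ => Y.t (σ (b ζ).1)) =ᶠ[𝓝 τ] fun ζ => (b ζ).2 := by
      refine (hφ (Y.t (k τ))).eventuallyEq_of_comp
        ((Y.smooth_t.continuous.tendsto _).comp hl) ?_ ?_
      · rw [(hk τ).2.2]
        exact hb₂.continuous.tendsto τ
      · filter_upwards [h₂] with ζ hζ
        rw [← φ.map_t, hζ]
        exact congrArg Prod.snd (hab ζ)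
    have h₄ : ContMDiffAt T.model Y.Ar.model ∞ (fun ζ => σ (b ζ).1) τ :=
      ContMDiffAt.comp (g := σ) τ (by rw [← (hk τ).2.1]; exact hσ.smooth.self_of_nhds) (hb₁ τ)
    refine h₄.congr_of_eventuallyEq ?_
    filter_upwards [h₁, h₂, h₃] with ζ g₁ g₂ g₃
    exact (hku ζ _ ⟨g₂, g₁, g₃⟩).symm
  · rintro k' ⟨-, h₁, h₂⟩
    exact funext fun τ =>
      hku τ _ ⟨h₁ τ, congrArg Prod.fst (h₂ τ), congrArg Prod.snd (h₂ τ)⟩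

/-- Morita equivalences of étale groupoids are the local diffeomorphisms on objects that are
equivalences of abstract groupoids. -/
theorem moritaEquivalence_iff {φ : Hom Y X} (hY : IsEtale Y) (hX : IsEtale X) :
    @moritaEquivalence Y X φ ↔ IsLocalDiffeomorph Y.Ob.model X.Ob.model ∞ φ.onOb ∧
      φ.IsFullyFaithful ∧ φ.IsEssSurj := by
  refine ⟨fun h => ⟨isLocalDiffeomorph_onOb hY hX h, isFullyFaithful_of_isCartesianSquare h.2,
    isEssSurj_of_moritaEquivalence h⟩, fun ⟨hφ, hf, hs⟩ =>
    ⟨⟨SmoothManifold.fiberProduct X.smooth_s hφ, fun x => ?_, ?_⟩,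
      isCartesianSquare_of_isFullyFaithful hY hX hφ hf⟩⟩
  · obtain ⟨y, g, hgs, hgt⟩ := hs x
    exact ⟨⟨(g, y), hgs⟩, hgt⟩
  · exact SmoothManifold.submersion_of_isLocalDiffeomorph fun p =>
      (SmoothManifold.isLocalDiffeomorph_fiberProduct_fst X.smooth_s hφ p).comp _ _
        (hX.isLocalDiffeomorph_t _)

end Hom

/-! ### Two-out-of-six and saturation -/

theorem moritaEquivalence_id (hX : IsEtale X) : moritaEquivalence (𝟙 X) := by
  refine (Hom.moritaEquivalence_iff (φ := 𝟙 X) hX hX).2 ⟨fun x => ?_, fun x x' g hs ht =>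
    ⟨g, ⟨rfl, hs, ht⟩, fun k hk => hk.1⟩, fun x => ⟨x, X.e x, X.s_e x, X.t_e x⟩⟩
  exact .of_germ (σ := id) (.of_forall fun _ => contMDiffAt_id) (.of_forall fun _ => contMDiffAt_id)
    (.of_forall fun _ => rfl) (.of_forall fun _ => rfl)

/-- The two-out-of-six property of Morita equivalences of étale groupoids, at the last map. -/
theorem moritaEquivalence_of_two_out_of_six (hU : IsEtale U) (hZ : IsEtale Z) (hY : IsEtale Y)
    (hX : IsEtale X) {ξ : U ⟶ Z} {ψ : Z ⟶ Y} {φ : Y ⟶ X} (h : moritaEquivalence (ψ ≫ φ))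
    (h' : moritaEquivalence (ξ ≫ ψ)) : moritaEquivalence φ := by
  obtain ⟨hd, hf, hs⟩ := (Hom.moritaEquivalence_iff hZ hX).1 h
  obtain ⟨hd', hf', hs'⟩ := (Hom.moritaEquivalence_iff hU hY).1 h'
  refine (Hom.moritaEquivalence_iff hY hX).2
    ⟨fun y => ?_, .of_two_out_of_six hf hf' hs', .of_comp hs⟩
  -- `l` joins an object in the image of `ξ ≫ ψ` to `y`, so it suffices to treat its source.
  obtain ⟨v, l, hl, rfl⟩ := hs' y
  refine Hom.isLocalDiffeomorphAt_target hY hX l ?_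
  rw [hl]
  exact .of_two_out_of_six (f := ψ.onOb) (k := ξ.onOb) ξ.smooth_onOb.continuous.continuousAt
    (.of_forall ψ.smooth_onOb) (.of_forall φ.smooth_onOb) (hd' v) (hd (ξ.onOb v))

/-- In a full subcategory of étale groupoids, the Morita equivalences are right saturated. -/
theorem isRightSaturated_moritaEquivalence {P : ObjectProperty LieGroupoid.{u}}
    (hP : P ≤ IsEtale) : IsRightSaturated
      (fun _ _ f => moritaEquivalence f.hom : MorphismProperty P.FullSubcategory) := by
  ext B A f
  constructor
  · intro hf
    exact ⟨B, B, 𝟙 B, 𝟙 B, by rwa [Category.id_comp],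
      by rw [Category.id_comp]; exact moritaEquivalence_id (hP _ B.property)⟩
  · rintro ⟨C, D, g, h, hgf, hhg⟩
    exact moritaEquivalence_of_two_out_of_six (hP _ D.property) (hP _ C.property)
      (hP _ B.property) (hP _ A.property) hgf hhg

end LieGroupoid

end

theorem mainTheorem8 :
    (∀ (U Z Y X : EGpd.{u}) (ξ : U ⟶ Z) (ψ : Z ⟶ Y) (φ : Y ⟶ X),
      wEGpd (ψ ≫ φ) → wEGpd (ξ ≫ ψ) → wEGpd φ) ∧
    IsRightSaturated wEGpd.{u} ∧
    IsRightSaturated wPEGpd.{u} ∧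
    IsRightSaturated wPEEGpd.{u} :=
  ⟨fun U Z Y X _ _ _ h h' => LieGroupoid.moritaEquivalence_of_two_out_of_six U.property Z.property
      Y.property X.property h h',
    LieGroupoid.isRightSaturated_moritaEquivalence le_rfl,
    LieGroupoid.isRightSaturated_moritaEquivalence inf_le_left,
    LieGroupoid.isRightSaturated_moritaEquivalence (inf_le_left.trans inf_le_left)⟩
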